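/- Let $X,Y$ be real locally convex Hausdorff topological vector spaces and let $Z$ be a real normed space. Let $K\subsetneq Y$ be a closed convex cone with nonempty interior and $S\subset Z$ a nonempty closed convex cone, with positive dual cones $K^+\subset Y^*$ and $S^+\subset Z^*$. Let $Y^\bullet=Y\cup\{-\infty_Y,+\infty_Y\}$ and $Z^\bullet=Z\cup\{-\infty_Z,+\infty_Z\}$, where $\pm\infty$ plus a vector is $\pm\infty$. For $a,b\in Y$ write $a<_K b$ if $a-b\in-\operatorname{int}K$, and let $-\infty_Y<_K y<_K+\infty_Y$ for $y\in Y$ and $-\infty_Y<_K+\infty_Y$. For $M\subset Y^\bullet$: - $\operatorname{WInf}M$ is the set of $w\in Y^\bullet$ such that $v\not<_K w$ for all $v\in M$, and for every $w'\in Y^\bullet$ with $w<_K w'$ there is $v\in M$ with $v<_K w'$; - $\operatorname{WSup}M$ is the set of $w\in Y^\bullet$ such that $w\not<_K v$ for all $v\in M$, and for every $w'\in Y^\bullet$ with $w'<_K w$ there is $v\in M$ with $w'<_K v$; - $\operatorname{WMax}M=M\cap\operatorname{WSup}M$. Let $\mathcal U$ be a nonempty compact topological space, $C\subset X$, and let $F:X\to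 Y^\bullet$ and $G_u:X\to Z^\bullet$ ($u\in\mathcal U$) be proper maps, i.e. they never take the value $-\infty$ and are not identically $+\infty$. Put $\operatorname{dom}F=\{x:F(x)\ne+\infty_Y\}$ and $A=\{x\in C: G_u(x)\in -S\ \text{for all }u\in\mathcal U\}$, and assume $A\cap\operatorname{dom}F\neq\emptyset$. The composition of a linear map (or functional) with $G_u$ or $F$ takes the value $+\infty$ where $G_u$ or $F$ does. Assume: - $(\mathcal H_0)$ $C$ is nonempty, closed and convex; the epigraph $\{(x,y)\in X\times Y:y\in F(x)+K\}$ is convex and $y^*\circ F$ is lower semicontinuous for every $y^*\in K^+\setminus\{0\}$; for every $u\in\mathcal U$ the epigraph $\{(x,z)\in X\times Z:z\in G_u(x)+S\}$ is convex and closed. - $(\mathcal H_1)$ For all $z_1^*,z_2^*\in S^+$ and $u_1,u_2\in\mathcal U$ there are $z^*\in S^+$ and $u\in\mathcal U$ with $(z_1^*\circ G_{u_1})(x)+(z_2^*\circ G_{u_2})(x)\le(z^*\circ G_u)(x)$ for all $x\in C\cap\operatorname{dom}F$. - $(\mathcal H_2)$ For every $x\in C\cap\operatorname{dom}F$: if a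 net $(z^*_\alpha,u_\alpha,r_\alpha)$ in $S^+\times\mathcal U\times\mathbb R$ satisfies $(z^*_\alpha\circ G_{u_\alpha})(x)\ge r_\alpha$ for all $\alpha$ and $z^*_\alpha\to z^*\in S^+$ weak-$*$, $u_\alpha\to u\in\mathcal U$, $r_\alpha\to r\in\mathbb R$, then $(z^*\circ G_u)(x)\ge r$. - $(C_0)$ For every $u\in\mathcal U$ there is $x_u\in C\cap\operatorname{dom}F$ with $G_u(x_u)\in-\operatorname{int}S$. Let $\mathcal L_+(S,K)$ be the set of continuous linear $T:Z\to Y$ with $T(S)\subset K$, and $\mathcal L_+^w(S,K)$ the set of those with $T(S)\cap(-\operatorname{int}K)=\emptyset$. Then for every continuous linear $L:X\to Y$, $$\operatorname{WMax}\bigcup_{(T,u)\in\mathcal L_+(S,K)\times\mathcal U}\operatorname{WInf}\{(F-L+T\circ G_u)(x):x\in C\}=\operatorname{WInf}\{F(x)-L(x):x\in A\}$$ and $$\operatorname{WMax}\bigcup_{(T,u)\in\mathcal L^w_+(S,K)\times\mathcal U}\operatorname{WInf}\{(F-L+T\circ G_u)(x)+T(s):(x,s)\in C\times S\}=\operatorname{WInf}\{F(x)-L(x):x\in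 A\}.$$ That is, robust strong stable duality holds for the robust vector problem (RVP) with each of its two duals, the Lagrangian robust dual (RVD) and the weak Lagrangian robust dual (RVD$_w$). -/

import Mathlib

open Set Filter Topology
open scoped Pointwise

namespace RobustVector

/-- The enlarged space `Y ∪ {-∞, +∞}` obtained from a vector space `Y` by attaching a smallest
element `negInf` and a greatest element `posInf`. -/
inductive Bullet (Y : Type*) where
  | negInf : Bullet Y
  | pt : Y → Bullet Y
  | posInf : Bullet Y

namespace Bullet

/-- Addition on the enlarged space: `±∞ + y = y + ±∞ = ±∞`.  The sums of opposite infinities, which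
are not used, get the value `-∞`. -/
def add {Y : Type*} [Add Y] : Bullet Y → Bullet Y → Bullet Y
  | negInf, _ => negInf
  | pt _, negInf => negInf
  | pt a, pt b => pt (a + b)
  | pt _, posInf => posInf
  | posInf, negInf => negInf
  | posInf, pt _ => posInf
  | posInf, posInf => posInf

instance {Y : Type*} [Add Y] : Add (Bullet Y) := ⟨add⟩

/-- The extension of a map `Z → Y` to the enlarged spaces, `±∞ ↦ ±∞`.  Thus
`fun x => (G x).map T` is the composite `T ∘ G`, with value `+∞` wherever `G x = +∞`. -/
def map {Z Y : Type*} (T : Z → Y) : Bullet Z → Bullet Y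
  | negInf => negInf
  | pt z => pt (T z)
  | posInf => posInf

/-- The extended-real value `⟨y*, y⟩` of a functional `y*` at a point of the enlarged space. -/
noncomputable def pair {Y : Type*} (f : Y → ℝ) : Bullet Y → EReal
  | negInf => ⊥
  | pt y => ((f y : ℝ) : EReal)
  | posInf => ⊤

/-- The weak ordering `v <_K w` generated by `K`: `a - b ∈ -int K` on `Y`, and
`-∞ <_K y <_K +∞`. -/
def WLt {Y : Type*} [AddCommGroup Y] [TopologicalSpace Y] (K : Set Y) :
    Bullet Y → Bullet Y → Prop
  | negInf, negInf => False
  | negInf, pt _ => True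
  | negInf, posInf => True
  | pt _, negInf => False
  | pt a, pt b => a - b ∈ -interior K
  | pt _, posInf => True
  | posInf, _ => False

end Bullet

section Orders

variable {Y : Type*} [AddCommGroup Y] [TopologicalSpace Y]

/-- The weak infimum of `M`: the set of its weakly infimal elements.  For `M = ∅` this is
`{+∞}` as soon as `int K` is nonempty. -/
def wInf (K : Set Y) (M : Set (Bullet Y)) : Set (Bullet Y) :=
  {w | (∀ v ∈ M, ¬ Bullet.WLt K v w) ∧
    ∀ w', Bullet.WLt K w w' → ∃ v ∈ M, Bullet.WLt K v w'}

/-- The weak supremum of `M`: the set of its weakly supremal elements.  For `M = ∅` this is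
`{-∞}` as soon as `int K` is nonempty. -/
def wSup (K : Set Y) (M : Set (Bullet Y)) : Set (Bullet Y) :=
  {w | (∀ v ∈ M, ¬ Bullet.WLt K w v) ∧
    ∀ w', Bullet.WLt K w' w → ∃ v ∈ M, Bullet.WLt K w' v}

/-- The weak maximum of `M`. -/
def wMax (K : Set Y) (M : Set (Bullet Y)) : Set (Bullet Y) := M ∩ wSup K M

end Orders

section Maps

variable {X Y : Type*}

/-- The effective domain `{x | F x ≠ +∞}`. -/
def dom (F : X → Bullet Y) : Set X := {x | F x ≠ Bullet.posInf}

/-- `F` is proper: nonempty effective domain, and the value `-∞` is not taken. -/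
def IsProper (F : X → Bullet Y) : Prop := (dom F).Nonempty ∧ ∀ x, F x ≠ Bullet.negInf

/-- The `K`-epigraph `{(x, y) | y ∈ F x + K}`. -/
def epigraph [Add Y] (K : Set Y) (F : X → Bullet Y) : Set (X × Y) :=
  {p | ∃ k ∈ K, Bullet.pt p.2 = F p.1 + Bullet.pt k}

/-- The positive dual cone `K⁺ = {y* ∈ Y* | ⟨y*, k⟩ ≥ 0 for all k ∈ K}`; the dual space carries
the weak-* topology. -/
def dualCone [AddCommGroup Y] [Module ℝ Y] [TopologicalSpace Y] (K : Set Y) :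
    Set (WeakDual ℝ Y) :=
  {f | ∀ k ∈ K, 0 ≤ f k}

/-- `F` is `K`-convex: its `K`-epigraph is convex. -/
def IsConeConvex [AddCommGroup X] [Module ℝ X] [AddCommGroup Y] [Module ℝ Y] (K : Set Y)
    (F : X → Bullet Y) : Prop :=
  Convex ℝ (epigraph K F)

/-- `F` is `K`-epi closed: its `K`-epigraph is closed. -/
def IsEpiClosed [TopologicalSpace X] [AddCommGroup Y] [TopologicalSpace Y] (K : Set Y)
    (F : X → Bullet Y) : Prop :=
  IsClosed (epigraph K F)

/-- `F` is positively `K`-lsc: `y* ∘ F` is lower semicontinuous for every nonzero `y* ∈ K⁺`. -/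
def IsPositivelyLsc [TopologicalSpace X] [AddCommGroup Y] [Module ℝ Y] [TopologicalSpace Y]
    (K : Set Y) (F : X → Bullet Y) : Prop :=
  ∀ f ∈ dualCone K, f ≠ 0 → LowerSemicontinuous fun x => (F x).pair f

end Maps

section Uncertainty

variable {Z U : Type*} [AddCommGroup Z] [Module ℝ Z] [TopologicalSpace Z]

/-- The family `(g ν)`, `ν ∈ I`, of maps on `U` is uniformly `S⁺`-concave. -/
def UniformlyConcave {ι : Type*} (S : Set Z) (I : Set ι) (g : ι → U → Bullet Z) : Prop :=
  ∀ z₁ ∈ dualCone S, ∀ z₂ ∈ dualCone S, ∀ u₁ u₂ : U, ∃ z ∈ dualCone S, ∃ u : U,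
    ∀ ν ∈ I, (g ν u₁).pair z₁ + (g ν u₂).pair z₂ ≤ (g ν u).pair z

/-- `g` is `S⁺`-uniformly usc: whenever a net `(z*_α, u_α, r_α)` in `S⁺ × U × ℝ` with
`(z*_α ∘ g)(u_α) ≥ r_α` converges to `(z*, u, r)` in `S⁺ × U × ℝ` (weak-* in the first variable),
one has `(z* ∘ g)(u) ≥ r`.  Nets are expressed by proper filters on the space of triples. -/
def UniformlyUsc [TopologicalSpace U] (S : Set Z) (g : U → Bullet Z) : Prop :=
  ∀ (l : Filter (WeakDual ℝ Z × U × ℝ)) (z : WeakDual ℝ Z) (u : U) (r : ℝ), l.NeBot →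
    z ∈ dualCone S →
    (∀ᶠ p in l, p.1 ∈ dualCone S ∧ (p.2.2 : EReal) ≤ (g p.2.1).pair p.1) →
    Tendsto (fun p : WeakDual ℝ Z × U × ℝ => p.1) l (𝓝 z) →
    Tendsto (fun p : WeakDual ℝ Z × U × ℝ => p.2.1) l (𝓝 u) →
    Tendsto (fun p : WeakDual ℝ Z × U × ℝ => p.2.2) l (𝓝 r) →
    (r : EReal) ≤ (g u).pair z

end Uncertainty

section Problems

variable {X Y Z U : Type*}
  [AddCommGroup X] [Module ℝ X] [TopologicalSpace X]
  [AddCommGroup Y] [Module ℝ Y] [TopologicalSpace Y]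
  [AddCommGroup Z] [Module ℝ Z] [TopologicalSpace Z]

/-- The feasible set `C ∩ ⋂ u, (G u)⁻¹(-S)`. -/
def feasible (S : Set Z) (C : Set X) (G : U → X → Bullet Z) : Set X :=
  {x | x ∈ C ∧ ∀ u, G u x ∈ Bullet.pt '' (-S)}

/-- The cone of positive operators: `T(S) ⊆ K`. -/
def posOps (S : Set Z) (K : Set Y) : Set (Z →L[ℝ] Y) := {T | T '' S ⊆ K}

/-- The cone of weakly positive operators: `T(S) ∩ (-int K) = ∅`. -/
def weakPosOps (S : Set Z) (K : Set Y) : Set (Z →L[ℝ] Y) := {T | T '' S ∩ (-interior K) = ∅}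

/-- The Lagrangian `(F - L + T ∘ G_u)(x)` of the problem perturbed by `L`. -/
def lagrangian (F : X → Bullet Y) (G : U → X → Bullet Z) (L : X →L[ℝ] Y)
    (T : Z →L[ℝ] Y) (u : U) (x : X) : Bullet Y :=
  F x + Bullet.pt (-L x) + (G u x).map T

/-- The objective values `F x - L x`, `x` feasible, of the perturbed primal problem. -/
def primalValues (S : Set Z) (C : Set X) (F : X → Bullet Y) (G : U → X → Bullet Z)
    (L : X →L[ℝ] Y) : Set (Bullet Y) :=
  (fun x => F x + Bullet.pt (-L x)) '' feasible S C G

/-- The union over `T` positive and `u ∈ U` of the weak infima over `x ∈ C` of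
`(F - L + T ∘ G_u)(x)`: the values of the Lagrangian robust dual of the perturbed problem. -/
def dualValues (K : Set Y) (S : Set Z) (C : Set X) (F : X → Bullet Y) (G : U → X → Bullet Z)
    (L : X →L[ℝ] Y) : Set (Bullet Y) :=
  ⋃ T ∈ posOps S K, ⋃ u : U, wInf K ((fun x => lagrangian F G L T u x) '' C)

/-- The union over `T` weakly positive and `u ∈ U` of the weak infima over `(x, s) ∈ C × S` of
`(F - L + T ∘ G_u)(x) + T s`: the values of the weak Lagrangian robust dual of the perturbed
problem. -/
def weakDualValues (K : Set Y) (S : Set Z) (C : Set X) (F : X → Bullet Y)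
    (G : U → X → Bullet Z) (L : X →L[ℝ] Y) : Set (Bullet Y) :=
  ⋃ T ∈ weakPosOps S K, ⋃ u : U,
    wInf K ((fun p : X × Z => lagrangian F G L T u p.1 + Bullet.pt (T p.2)) '' (C ×ˢ S))

/-- Robust strong stable duality for the problem and its Lagrangian robust dual. -/
def StrongStableDuality (K : Set Y) (S : Set Z) (C : Set X) (F : X → Bullet Y)
    (G : U → X → Bullet Z) : Prop :=
  ∀ L : X →L[ℝ] Y, wMax K (dualValues K S C F G L) = wInf K (primalValues S C F G L)

/-- Robust strong stable duality for the problem and its weak Lagrangian robust dual. -/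
def WeakStrongStableDuality (K : Set Y) (S : Set Z) (C : Set X) (F : X → Bullet Y)
    (G : U → X → Bullet Z) : Prop :=
  ∀ L : X →L[ℝ] Y, wMax K (weakDualValues K S C F G L) = wInf K (primalValues S C F G L)

end Problems

end RobustVector

/-! Weak duality is a comparison at feasible points: there `G u x ∈ -S`, so a positive `T` can only
lower the objective, while for weakly positive `T` the choice `s = -G u x` cancels `T (G u x)`.
Hence no primal value lies weakly below a dual one. By `wMax_eq_wInf` it remains to show that every
weakly infimal primal value `w` is itself a dual value.

For finite `w = b`, `exists_separating_functional` gives `f`, nonnegative on `K` and positive on its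
interior, with `f b` a lower bound of the scalar problem of minimizing `f ∘ (F - L)` on the feasible
set. Scalar robust duality (`exists_robust_multiplier`) yields one pair `(z, u)` with `f b ≤ f (F x
- L x) + z (G u x)` wherever both maps are finite. The rank-one operator `T = z(·) k / f k`, with
`k` interior to `K`, is positive and satisfies `f ∘ T = z`, so no Lagrangian value lies weakly below
`b`.

The scalar multiplier comes from compactness. On finitely many points and up to `ε` it exists by
finite-dimensional separation, uniform concavity and Jensen. Normalizing the pairs `(z, 1)` places
the multipliers in a weak-* compact set, upper semicontinuity makes the constraints closed, and the
Slater condition keeps the coefficient of the objective positive in the limit. -/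

set_option linter.unusedSectionVars false

namespace RobustVector

/-! ### Solid convex cones and separation. -/

section Cone

variable {E : Type*} [AddCommGroup E] [Module ℝ E] [TopologicalSpace E] [IsTopologicalAddGroup E]
  [ContinuousSMul ℝ E] {K : ConvexCone ℝ E}

theorem zero_mem_of_isClosed (hK : IsClosed (K : Set E)) (hne : (K : Set E).Nonempty) :
    (0 : E) ∈ K :=
  ConvexCone.Pointed.of_nonempty_of_isClosed hne hK

theorem interior_add_mem {a b : E} (ha : a ∈ interior (K : Set E)) (hb : b ∈ K) :
    a + b ∈ interior (K : Set E) := by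
  have h : interior (K : Set E) + (K : Set E) ⊆ interior ((K : Set E) + (K : Set E)) :=
    subset_interior_add_left
  refine interior_mono ?_ (h (add_mem_add ha hb))
  rintro _ ⟨x, hx, y, hy, rfl⟩
  exact K.add_mem hx hy

theorem add_interior_mem {a b : E} (ha : a ∈ K) (hb : b ∈ interior (K : Set E)) :
    a + b ∈ interior (K : Set E) :=
  add_comm b a ▸ interior_add_mem hb ha

theorem smul_interior_mem {a : E} {t : ℝ} (ht : 0 < t) (ha : a ∈ interior (K : Set E)) :
    t • a ∈ interior (K : Set E) := by
  have h : t • interior (K : Set E) ⊆ interior (t • (K : Set E)) :=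
    (interior_smul₀ ht.ne' _).symm.subset
  refine interior_mono ?_ (h (smul_mem_smul_set ha))
  rintro _ ⟨x, hx, rfl⟩
  exact K.smul_mem ht hx

/-- A point plus a large multiple of an interior point of a cone lies in the interior. -/
theorem exists_add_smul_mem_interior (y : E) {k : E} (hk : k ∈ interior (K : Set E)) :
    ∃ t : ℝ, 0 < t ∧ y + t • k ∈ interior (K : Set E) := by
  -- For small `t > 0` the point `t • y + k` is still interior; rescaling by `t⁻¹` gives the claim.
  have hc : Tendsto (fun t : ℝ => t • y + k) (𝓝[>] 0) (𝓝 k) := by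
    have : Continuous fun t : ℝ => t • y + k := by fun_prop
    simpa using (this.tendsto 0).mono_left nhdsWithin_le_nhds
  obtain ⟨t, ht, ht0⟩ := ((hc.eventually (isOpen_interior.mem_nhds hk)).and
    self_mem_nhdsWithin).exists
  have ht0 : 0 < t := ht0
  refine ⟨t⁻¹, inv_pos.2 ht0, ?_⟩
  have := smul_interior_mem (inv_pos.2 ht0) ht
  rwa [smul_add, smul_smul, inv_mul_cancel₀ ht0.ne', one_smul] at this

theorem zero_notMem_interior (hK : (K : Set E) ≠ univ) : (0 : E) ∉ interior (K : Set E) := by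
  intro h0
  refine hK (eq_univ_of_forall fun y => ?_)
  -- With `0` as the interior point the added multiple vanishes, so `y` itself lies in the cone.
  obtain ⟨t, -, ht⟩ := exists_add_smul_mem_interior y h0
  simpa using interior_subset ht

/-- A nonzero functional that is nonnegative on a cone is positive on its interior. -/
theorem pos_of_mem_interior (f : E →L[ℝ] ℝ) (hf : f ≠ 0) (hK : ∀ k ∈ K, 0 ≤ f k) {k : E}
    (hk : k ∈ interior (K : Set E)) : 0 < f k := by
  -- A nonzero functional is open, so the image is an open subset of `[0, ∞)` and avoids `0`.
  have ho : IsOpen (f '' interior (K : Set E)) :=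
    f.isOpenMap_of_ne_zero hf _ isOpen_interior
  have hs : f '' interior (K : Set E) ⊆ interior (Ici 0) := by
    refine ho.subset_interior_iff.2 ?_
    rintro _ ⟨x, hx, rfl⟩
    exact hK x (interior_subset hx)
  rw [interior_Ici] at hs
  exact hs (mem_image_of_mem f hk)

/-- Separation of a point `w` from a convex set none of whose elements lies below `w` in the weak
order of a solid cone. -/
theorem exists_separating_functional (hne : (interior (K : Set E)).Nonempty) {P : Set E}
    (hP : Convex ℝ (P + (K : Set E))) (hPne : P.Nonempty) (h0 : (0 : E) ∈ K) {w : E}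
    (hw : ∀ p ∈ P, w - p ∉ interior (K : Set E)) :
    ∃ f : E →L[ℝ] ℝ, f ≠ 0 ∧ (∀ k ∈ K, 0 ≤ f k) ∧ ∀ p ∈ P, f w ≤ f p := by
  have hmem : ∀ a, a ∈ (fun y => w - y) ⁻¹' interior (K : Set E) ↔ w - a ∈ interior (K : Set E) :=
    fun _ => Iff.rfl
  have hconv : Convex ℝ ((fun y => w - y) ⁻¹' interior (K : Set E)) := by
    intro a ha b hb s t hs ht hst
    have := K.convex.interior ha hb hs ht hst
    have e : s • (w - a) + t • (w - b) = w - (s • a + t • b) := by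
      have : w = (s + t) • w := by rw [hst, one_smul]
      rw [smul_sub, smul_sub]
      nth_rewrite 3 [this]
      rw [add_smul]; abel
    simpa only [mem_preimage, ← e] using this
  -- The open convex set `w - interior K` is separated from `P + K`. As `P + K` is unbounded in the
  -- directions of `K`, the functional cannot be negative there.
  obtain ⟨f, c, h1, h2⟩ := geometric_hahn_banach_open hconv
    (isOpen_interior.preimage (by fun_prop)) hP (by
      rw [Set.disjoint_left]
      rintro _ ha ⟨p, hp, k, hk, rfl⟩
      refine hw p hp ?_
      have := interior_add_mem ha hk
      convert this using 1
      simp only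
      abel)
  obtain ⟨p₀, hp₀⟩ := hPne
  obtain ⟨k₀, hk₀⟩ := hne
  have hK : ∀ k ∈ K, 0 ≤ f k := by
    intro k hk
    by_contra! hneg
    obtain ⟨n, hn⟩ := exists_nat_gt ((f p₀ - c) / -f k)
    have h3 := h2 (p₀ + ((n : ℝ) + 1) • k) (add_mem_add hp₀ (K.smul_mem (by positivity) hk))
    rw [div_lt_iff₀ (by linarith)] at hn
    simp only [map_add, map_smul, smul_eq_mul] at h3
    nlinarith
  have hwc : f w ≤ c := by
    have hlim : Tendsto (fun t : ℝ => f (w - t • k₀)) (𝓝[>] 0) (𝓝 (f w)) := by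
      have : Continuous fun t : ℝ => f (w - t • k₀) := by fun_prop
      simpa using (this.tendsto 0).mono_left nhdsWithin_le_nhds
    refine le_of_tendsto hlim ?_
    filter_upwards [self_mem_nhdsWithin] with t ht
    refine (h1 _ ?_).le
    rw [hmem, sub_sub_cancel]
    exact smul_interior_mem ht hk₀
  refine ⟨f, ?_, hK, fun p hp => hwc.trans (h2 p ⟨p, hp, 0, h0, add_zero p⟩)⟩
  rintro rfl
  have h3 := h1 (w - k₀) (by rw [hmem, sub_sub_cancel]; exact hk₀)
  have h4 := h2 p₀ ⟨p₀, hp₀, 0, h0, add_zero p₀⟩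
  simp only [zero_apply] at h3 h4
  linarith

end Cone

/-- A convex set of vectors that is closed downwards and misses the orthant `{q | ∀ i, -ε < q i}`
is separated from it by a probability vector. -/
theorem exists_weights_of_disjoint {ι : Type*} [Fintype ι] {Q : Set (ι → ℝ)} {ε : ℝ}
    (hQ : Convex ℝ Q) (hne : Q.Nonempty) (hmiss : ∀ q ∈ Q, ∃ i, q i ≤ -ε) :
    ∃ μ : ι → ℝ, (∀ i, 0 ≤ μ i) ∧ ∑ i, μ i = 1 ∧ ∀ q ∈ Q, ∑ i, μ i * q i ≤ -ε := by
  classical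
  have hconv : Convex ℝ (Set.univ.pi fun _ : ι => Ioi (-ε)) := convex_pi fun _ _ => convex_Ioi _
  have hopen : IsOpen (Set.univ.pi fun _ : ι => Ioi (-ε)) :=
    isOpen_set_pi finite_univ fun _ _ => isOpen_Ioi
  obtain ⟨f, c, h1, h2⟩ := geometric_hahn_banach_open hconv hopen hQ (by
    rw [Set.disjoint_left]
    intro q hq hqQ
    obtain ⟨i, hi⟩ := hmiss q hqQ
    exact absurd (hq i (mem_univ i)) (not_lt.2 hi))
  -- `f` is bounded above on an orthant that is unbounded upwards, so its coefficients are
  -- nonpositive; the sign is reversed.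
  set ν : ι → ℝ := fun i => -f (Pi.single i 1) with hν
  have hf : ∀ q : ι → ℝ, f q = -∑ i, ν i * q i := by
    intro q
    conv_lhs => rw [pi_eq_sum_univ' q]
    rw [map_sum, ← Finset.sum_neg_distrib]
    refine Finset.sum_congr rfl fun i _ => ?_
    rw [map_smul, smul_eq_mul, hν]
    ring
  have hν0 : ∀ i, 0 ≤ ν i := by
    intro i
    by_contra! hneg
    obtain ⟨n, hn⟩ := exists_nat_gt ((c - f fun _ => -ε + 1) / -ν i)
    rw [div_lt_iff₀ (by linarith)] at hn
    have h3 := h1 ((fun _ => -ε + 1) + (n : ℝ) • Pi.single i 1) (by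
      intro j _
      have : (0 : ℝ) ≤ (n : ℝ) * (Pi.single i 1 : ι → ℝ) j :=
        mul_nonneg (Nat.cast_nonneg n) (by by_cases h : j = i <;> simp [h])
      simp only [Pi.add_apply, Pi.smul_apply, smul_eq_mul, mem_Ioi]
      linarith)
    rw [map_add, map_smul, smul_eq_mul, show f (Pi.single i 1) = -ν i by simp [hν]] at h3
    linarith
  -- The bound `f < c` is passed to the corner `(-ε, …, -ε)` of the open orthant.
  have hνc : (∑ i, ν i) * ε ≤ c := by
    have hlim : Tendsto (fun t : ℝ => f fun _ => -ε + t) (𝓝[>] 0) (𝓝 ((∑ i, ν i) * ε)) := by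
      have e : (fun t : ℝ => f fun _ : ι => -ε + t) = fun t => (∑ i, ν i) * (ε - t) := by
        ext t; rw [hf, ← Finset.sum_mul]; ring
      rw [e]
      have : Continuous fun t : ℝ => (∑ i, ν i) * (ε - t) := by fun_prop
      simpa using (this.tendsto 0).mono_left nhdsWithin_le_nhds
    refine le_of_tendsto hlim ?_
    filter_upwards [self_mem_nhdsWithin] with t ht
    have ht : 0 < t := ht
    exact (h1 _ fun j _ => by simp only [mem_Ioi]; linarith).le
  have hpos : 0 < ∑ i, ν i := by
    refine lt_of_le_of_ne (Finset.sum_nonneg fun i _ => hν0 i) fun h => ?_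
    have hz : ∀ i, ν i = 0 := fun i =>
      (Finset.sum_eq_zero_iff_of_nonneg fun i _ => hν0 i).1 h.symm i (Finset.mem_univ i)
    obtain ⟨q, hq⟩ := hne
    have h3 := h1 (fun _ => -ε + 1) fun j _ => by simp only [mem_Ioi]; linarith
    have h4 := h2 q hq
    rw [hf] at h3 h4
    simp only [hz, zero_mul, Finset.sum_const_zero] at h3 h4
    linarith
  refine ⟨fun i => ν i / ∑ j, ν j, fun i => div_nonneg (hν0 i) hpos.le, ?_, fun q hq => ?_⟩
  · rw [← Finset.sum_div, div_self hpos.ne']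
  · have h4 := h2 q hq
    rw [hf] at h4
    have e : ∑ i, ν i / (∑ j, ν j) * q i = (∑ i, ν i * q i) / ∑ j, ν j := by
      rw [Finset.sum_div]; exact Finset.sum_congr rfl fun i _ => by ring
    rw [e, div_le_iff₀ hpos]
    linarith

end RobustVector

namespace RobustVector

/-! ### Extended values, epigraphs and Jensen's inequality. -/

namespace Bullet

/-- The vector represented by a finite point, and `0` at `±∞`. -/
def fin {Y : Type*} [Zero Y] : Bullet Y → Y
  | negInf => 0
  | pt y => y
  | posInf => 0

theorem eq_pt_fin {Y : Type*} [Zero Y] {v : Bullet Y} (h₁ : v ≠ negInf) (h₂ : v ≠ posInf) :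
    v = pt v.fin := by
  cases v <;> simp_all [fin]

theorem le_pair_pt {Y : Type*} {f : Y → ℝ} {y : Y} {q : ℝ} :
    (q : EReal) ≤ (pt y).pair f ↔ q ≤ f y := EReal.coe_le_coe_iff

theorem le_pair_posInf {Y : Type*} {f : Y → ℝ} {q : EReal} : q ≤ (posInf : Bullet Y).pair f :=
  le_top

theorem le_pair_of_le_fin {Y : Type*} [Zero Y] {f : Y → ℝ} {v : Bullet Y} {q : ℝ}
    (hv : v ≠ negInf) (h : q ≤ f v.fin) : (q : EReal) ≤ v.pair f := by
  cases v with
  | negInf => exact absurd rfl hv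
  | pt y => exact le_pair_pt.2 h
  | posInf => exact le_pair_posInf

end Bullet

open Bullet

theorem mem_epigraph_iff {X Y : Type*} [AddCommGroup Y] {K : Set Y} {F : X → Bullet Y} {x : X}
    {y : Y} : (x, y) ∈ epigraph K F ↔ ∃ b, F x = pt b ∧ y - b ∈ K := by
  constructor
  · rintro ⟨k, hk, he⟩
    simp only at he
    generalize F x = v at he
    cases v with
    | negInf => cases he
    | posInf => cases he
    | pt b =>
      have he : pt y = pt (b + k) := he
      refine ⟨b, rfl, ?_⟩
      rwa [pt.inj he, add_sub_cancel_left]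
  · rintro ⟨b, hb, hk⟩
    refine ⟨y - b, hk, ?_⟩
    simp only [hb]
    exact congrArg pt (add_sub_cancel b y).symm

theorem mem_epigraph_of_eq {X Y : Type*} [AddCommGroup Y] {K : Set Y} {F : X → Bullet Y} {x : X}
    {y b : Y} (hx : F x = pt b) (h : y - b ∈ K) : (x, y) ∈ epigraph K F :=
  mem_epigraph_iff.2 ⟨b, hx, h⟩

/-- Jensen's inequality for cone-convex maps. -/
theorem IsConeConvex.map_sum {X Y ι : Type*} [AddCommGroup X] [Module ℝ X] [AddCommGroup Y]
    [Module ℝ Y] {K : Set Y} {F : X → Bullet Y} (hF : IsConeConvex K F) (h0 : (0 : Y) ∈ K)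
    {t : Finset ι} {μ : ι → ℝ} {x : ι → X} {y : ι → Y} (hμ : ∀ i ∈ t, 0 ≤ μ i)
    (hμ1 : ∑ i ∈ t, μ i = 1) (hy : ∀ i ∈ t, F (x i) = pt (y i)) :
    ∃ b, F (∑ i ∈ t, μ i • x i) = pt b ∧ ∑ i ∈ t, μ i • y i - b ∈ K := by
  have h := Convex.sum_mem hF hμ hμ1 (z := fun i => (x i, y i)) fun i hi =>
    mem_epigraph_of_eq (hy i hi) ((sub_self (y i)).symm ▸ h0)
  refine mem_epigraph_iff.1 ?_
  convert h using 1
  simp only [Prod.smul_mk, Prod.ext_iff, Prod.fst_sum, Prod.snd_sum, and_self]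

/-! ### Robust Lagrangian duality for scalar problems. -/

section Multiplier

variable {X Z U : Type*} [AddCommGroup X] [Module ℝ X]
  [NormedAddCommGroup Z] [NormedSpace ℝ Z]
  {S : ConvexCone ℝ Z} {D : Set X} {f : X → ℝ} {r : ℝ} {G : U → X → Bullet Z}

theorem smul_mem_dualCone {z : WeakDual ℝ Z} {t : ℝ} (ht : 0 ≤ t)
    (hz : z ∈ dualCone (S : Set Z)) : t • z ∈ dualCone (S : Set Z) := fun s hs =>
  mul_nonneg ht (hz s hs)

theorem zero_mem_dualCone : (0 : WeakDual ℝ Z) ∈ dualCone (S : Set Z) := fun _ _ => le_rfl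

theorem isClosed_dualCone : IsClosed (dualCone (S : Set Z)) := by
  have : dualCone (S : Set Z) = ⋂ s ∈ S, {z : WeakDual ℝ Z | 0 ≤ z s} := by
    ext z; simp [dualCone]
  rw [this]
  exact isClosed_biInter fun s _ => isClosed_le continuous_const (WeakDual.eval_continuous s)

/-- The part of the dual cone cut off by an interior point of the cone is weak-* compact. -/
theorem isCompact_dualCone_inter {s₀ : Z} (hs₀ : s₀ ∈ interior (S : Set Z)) :
    IsCompact {z : WeakDual ℝ Z | z ∈ dualCone (S : Set Z) ∧ z s₀ ≤ 1} := by
  -- If `s₀ ± h ∈ S`, then `|z h| ≤ z s₀ ≤ 1`: the set lies in the polar of a neighbourhood of `0`,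
  -- and Banach–Alaoglu applies.
  have hV : {h : Z | s₀ + h ∈ S ∧ s₀ - h ∈ S} ∈ 𝓝 (0 : Z) := by
    have hS : (S : Set Z) ∈ 𝓝 s₀ := mem_interior_iff_mem_nhds.1 hs₀
    have h1 : Tendsto (fun h : Z => s₀ + h) (𝓝 0) (𝓝 s₀) :=
      (show Continuous fun h : Z => s₀ + h by fun_prop).tendsto' 0 _ (add_zero s₀)
    have h2 : Tendsto (fun h : Z => s₀ - h) (𝓝 0) (𝓝 s₀) :=
      (show Continuous fun h : Z => s₀ - h by fun_prop).tendsto' 0 _ (sub_zero s₀)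
    exact (h1.eventually hS).and (h2.eventually hS)
  refine (WeakDual.isCompact_polar ℝ hV).of_isClosed_subset
    (isClosed_dualCone.inter (isClosed_le (WeakDual.eval_continuous s₀) continuous_const)) ?_
  rintro z ⟨hz, hz1⟩ h ⟨h₁, h₂⟩
  have a := hz _ h₁
  have b := hz _ h₂
  rw [map_add] at a
  rw [map_sub] at b
  change ‖z h‖ ≤ 1
  rw [Real.norm_eq_abs, abs_le]
  constructor <;> linarith

/-- If `r` bounds `f` below on the robust feasible set, then on finitely many points some
multiplier makes the Lagrangian at least `r - ε`. -/
theorem exists_approx_multiplier_finset [Nonempty U] (hS : IsClosed (S : Set Z))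
    (hSne : (S : Set Z).Nonempty)
    (hf : ConvexOn ℝ D f) (hG : ∀ u, IsConeConvex (S : Set Z) (G u))
    (hGneg : ∀ u x, G u x ≠ negInf)
    (hconc : UniformlyConcave (S : Set Z) D fun x u => G u x)
    (hr : ∀ x ∈ D, (∀ u, G u x ∈ pt '' (-(S : Set Z))) → r ≤ f x)
    (s : Finset X) (hs : ∀ x ∈ s, x ∈ D) {ε : ℝ} (hε : 0 < ε) :
    ∃ z ∈ dualCone (S : Set Z), ∃ u, ∀ x ∈ s, ((r - ε - f x : ℝ) : EReal) ≤ (G u x).pair z := by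
  classical
  by_contra! hcon
  have h0 : (0 : Z) ∈ S := zero_mem_of_isClosed hS hSne
  -- `Q` consists of the vectors dominated on `s` by some `f - r + z ∘ G u`. A `q ∈ Q` with all
  -- coordinates above `-ε` would supply the desired multiplier.
  let Q : Set (s → ℝ) := {q | ∃ z ∈ dualCone (S : Set Z), ∃ u, ∀ i : s,
    ((q i + (r - f i) : ℝ) : EReal) ≤ (G u i).pair z}
  have hQfin : ∀ z ∈ dualCone (S : Set Z), ∀ u,
      (fun i : s => f i - r + z (G u i).fin) ∈ Q := fun z hz u =>
    ⟨z, hz, u, fun i => le_pair_of_le_fin (hGneg u i) (by linarith)⟩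
  have hQne : Q.Nonempty := ⟨_, hQfin 0 zero_mem_dualCone (Classical.arbitrary U)⟩
  have hQ : Convex ℝ Q := by
    rw [convex_iff_forall_pos]
    rintro q ⟨z, hz, u, h⟩ q' ⟨z', hz', u', h'⟩ a b ha hb hab
    obtain ⟨w, hw, v, hv⟩ := hconc _ (smul_mem_dualCone ha.le hz) _ (smul_mem_dualCone hb.le hz') u u'
    refine ⟨w, hw, v, fun i => le_trans ?_ (hv i (hs i i.2))⟩
    have h := h i
    have h' := h' i
    have hn := hGneg u i
    have hn' := hGneg u' i
    have key : ∀ (c : ℝ) (ζ : WeakDual ℝ Z) (g : Bullet Z) (p : ℝ), 0 < c → g ≠ negInf →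
        (p : EReal) ≤ g.pair ζ → ((c * p : ℝ) : EReal) ≤ g.pair (c • ζ : WeakDual ℝ Z) := by
      intro c ζ g p hc hg hp
      cases g with
      | negInf => exact absurd rfl hg
      | posInf => exact le_pair_posInf
      | pt y => exact le_pair_pt.2 (mul_le_mul_of_nonneg_left (le_pair_pt.1 hp) hc.le)
    refine le_trans ?_ (add_le_add (key a z _ _ ha hn h) (key b z' _ _ hb hn' h'))
    rw [← EReal.coe_add, EReal.coe_le_coe_iff]
    simp only [Pi.add_apply, Pi.smul_apply, smul_eq_mul]
    have e : r - f i = (a + b) * (r - f i) := by rw [hab, one_mul]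
    linarith
  have hmiss : ∀ q ∈ Q, ∃ i, q i ≤ -ε := by
    rintro q ⟨z, hz, u, h⟩
    by_contra! hq
    obtain ⟨x, hx, hlt⟩ := hcon z hz u
    refine absurd ((h ⟨x, hx⟩).trans_lt hlt) (not_lt.2 (EReal.coe_le_coe_iff.2 ?_))
    have := hq ⟨x, hx⟩
    simp only at this ⊢
    linarith
  obtain ⟨μ, hμ, hμ1, hμQ⟩ := exists_weights_of_disjoint hQ hQne hmiss
  -- Points of zero weight are dropped, since `G u` may be `+∞` there.
  let t : Finset s := Finset.univ.filter fun i => μ i ≠ 0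
  have hsum : ∀ g : s → ℝ, ∑ i ∈ t, μ i * g i = ∑ i, μ i * g i := fun g =>
    Finset.sum_filter_of_ne fun i _ h hi => h (by rw [hi, zero_mul])
  have ht1 : ∑ i ∈ t, μ i = 1 := by
    rw [← hμ1]; exact Finset.sum_filter_of_ne fun i _ h => h
  have hfinite : ∀ u, ∀ i ∈ t, G u i = pt (G u i).fin := by
    intro u i hi
    refine eq_pt_fin (hGneg u i) fun hinf => ?_
    have hμi : 0 < μ i := lt_of_le_of_ne (hμ i) (Ne.symm (Finset.mem_filter.1 hi).2)
    set c : ℝ := ∑ j, μ j * (f j - r) with hc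
    -- At an infinite value coordinate `i` is unconstrained, even for `z = 0`. The spike contributes
    -- `|c|`, making the weighted sum `c + |c| ≥ 0 > -ε`.
    have hmem : (fun j : s => f j - r + (Pi.single i (|c| / μ i) : s → ℝ) j) ∈ Q := by
      refine ⟨0, zero_mem_dualCone, u, fun j => ?_⟩
      by_cases hj : j = i
      · subst hj; rw [hinf]; exact le_pair_posInf
      · refine le_pair_of_le_fin (hGneg u j) ?_
        change f j - r + (Pi.single i (|c| / μ i) : s → ℝ) j + (r - f j) ≤ (0 : ℝ)
        rw [Pi.single_eq_of_ne hj]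
        linarith
    have h := hμQ _ hmem
    simp only [mul_add (μ _), Finset.sum_add_distrib, ← hc, Pi.single_apply, mul_ite, mul_zero,
      Finset.sum_ite_eq', Finset.mem_univ, if_true] at h
    rw [mul_div_cancel₀ _ hμi.ne'] at h
    have := neg_abs_le c
    linarith
  set x₀ : X := ∑ i ∈ t, μ i • (i : X) with hx₀
  have hx₀D : x₀ ∈ D := hf.1.sum_mem (fun i _ => hμ i) ht1 fun i _ => hs i i.2
  have hfx₀ : f x₀ ≤ ∑ i, μ i * f i := by
    refine (hf.map_sum_le (fun i _ => hμ i) ht1 fun i _ => hs i i.2).trans_eq ?_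
    exact hsum fun i : s => f i
  have hval : ∀ z ∈ dualCone (S : Set Z), ∀ u,
      ∑ i, μ i * f i - r + z (∑ i ∈ t, μ i • (G u i).fin) ≤ -ε := by
    intro z hz u
    have h := hμQ _ (hQfin z hz u)
    rw [map_sum]
    simp only [map_smul, smul_eq_mul]
    rw [hsum]
    have e : ∑ i, μ i * (f i - r + z (G u i).fin) =
        ∑ i, μ i * f i - r + ∑ i, μ i * z (G u i).fin := by
      simp only [mul_add, mul_sub, Finset.sum_add_distrib, Finset.sum_sub_distrib]
      rw [← Finset.sum_mul, hμ1, one_mul]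
    rwa [e] at h
  have hfeas : ∀ u, G u x₀ ∈ pt '' (-(S : Set Z)) := by
    intro u
    obtain ⟨b, hb, hbS⟩ := (hG u).map_sum h0 (x := fun i : s => (i : X)) (fun i _ => hμ i) ht1
      (hfinite u)
    refine ⟨b, ?_, hb.symm⟩
    set y := ∑ i ∈ t, μ i • (G u i).fin with hy
    -- Otherwise some `g` in the dual cone has `g y > 0`, and its large multiples violate `hval`.
    have hyS : -y ∈ S := by
      by_contra hny
      lift S to ProperCone ℝ Z using ⟨hSne, hS⟩
      obtain ⟨g, hg, hgy⟩ := ProperCone.hyperplane_separation_point S hny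
      rw [map_neg, neg_lt_zero] at hgy
      obtain ⟨n, hn⟩ := exists_nat_gt ((r - ∑ i, μ i * f i) / g y)
      rw [div_lt_iff₀ hgy] at hn
      have h := hval ((n : ℝ) • (g : WeakDual ℝ Z))
        (smul_mem_dualCone n.cast_nonneg fun k hk => hg k hk) u
      have h : ∑ i, μ i * f i - r + (n : ℝ) * g y ≤ -ε := h
      linarith
    have := S.add_mem hyS hbS
    rwa [show -y + (y - b) = -b by abel] at this
  have h := hval 0 zero_mem_dualCone (Classical.arbitrary U)
  have h : ∑ i, μ i * f i - r + (0 : ℝ) ≤ -ε := h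
  have := hr x₀ hx₀D hfeas
  linarith

/-- Robust Lagrangian duality for a scalar convex problem, with attainment in the dual. -/
theorem exists_robust_multiplier [TopologicalSpace U] [CompactSpace U] [Nonempty U]
    (hS : IsClosed (S : Set Z)) (hSne : (S : Set Z).Nonempty)
    (hf : ConvexOn ℝ D f) (hG : ∀ u, IsConeConvex (S : Set Z) (G u))
    (hGneg : ∀ u x, G u x ≠ negInf)
    (hconc : UniformlyConcave (S : Set Z) D fun x u => G u x)
    (husc : ∀ x ∈ D, UniformlyUsc (S : Set Z) fun u => G u x)
    (hslater : ∀ u, ∃ x ∈ D, G u x ∈ pt '' (-interior (S : Set Z)))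
    (hr : ∀ x ∈ D, (∀ u, G u x ∈ pt '' (-(S : Set Z))) → r ≤ f x) :
    ∃ z ∈ dualCone (S : Set Z), ∃ u, ∀ x ∈ D, ∀ y, G u x = pt y → r ≤ f x + z y := by
  obtain ⟨s₀, hs₀⟩ : (interior (S : Set Z)).Nonempty := by
    obtain ⟨x, -, y, hy, -⟩ := hslater (Classical.arbitrary U)
    exact ⟨-y, hy⟩
  let B : Set (WeakDual ℝ Z) := {z | z ∈ dualCone (S : Set Z) ∧ z s₀ ≤ 1}
  have hB : IsCompact B := isCompact_dualCone_inter hs₀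
  -- This is the approximate multiplier inequality for the normalized functional `z / (1 + z s₀)`:
  -- with `p.1` denoting it, the objective has coefficient `1 - p.1 s₀ = 1 / (1 + z s₀)`.
  let Λ : D × Ioi (0 : ℝ) → Set (WeakDual ℝ Z × U) := fun i =>
    {p | p.1 ∈ B ∧ (((1 - p.1 s₀) * (r - i.2 - f i.1) : ℝ) : EReal) ≤ (G p.2 i.1).pair p.1}
  have hΛ : ∀ i, IsClosed (Λ i) := by
    intro i
    rw [isClosed_iff_ultrafilter]
    rintro ⟨z, u⟩ l hl hmem
    have hz : Tendsto Prod.fst (l : Filter (WeakDual ℝ Z × U)) (𝓝 z) :=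
      (continuous_fst.tendsto (z, u)).mono_left hl
    have hu : Tendsto Prod.snd (l : Filter (WeakDual ℝ Z × U)) (𝓝 u) :=
      (continuous_snd.tendsto (z, u)).mono_left hl
    have hmem : ∀ᶠ p in (l : Filter (WeakDual ℝ Z × U)), p ∈ Λ i := hmem
    have hzB : z ∈ B := hB.isClosed.mem_of_tendsto hz (hmem.mono fun p hp => hp.1)
    refine ⟨hzB, ?_⟩
    let φ : WeakDual ℝ Z × U → WeakDual ℝ Z × U × ℝ := fun p =>
      (p.1, p.2, (1 - p.1 s₀) * (r - i.2 - f i.1))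
    refine husc i.1 i.1.2 (map φ l) z u _ inferInstance hzB.1 ?_ ?_ ?_ ?_
    · exact eventually_map.2 (hmem.mono fun p hp => ⟨hp.1.1, hp.2⟩)
    · exact tendsto_map'_iff.2 hz
    · exact tendsto_map'_iff.2 hu
    · refine tendsto_map'_iff.2 ?_
      exact (tendsto_const_nhds.sub
        (((WeakDual.eval_continuous s₀).tendsto z).comp hz)).mul_const _
  have hfip : ∀ a : Finset (D × Ioi (0 : ℝ)), (B ×ˢ (univ : Set U) ∩ ⋂ i ∈ a, Λ i).Nonempty := by
    intro a
    classical
    -- One tolerance below all those in `a` reduces the claim to a single approximate multiplier.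
    have hε : ∀ᶠ ε in 𝓝[>] (0 : ℝ), ∀ i ∈ a, ε ≤ (i.2 : ℝ) := by
      refine (Filter.eventually_all_finset a).2 fun i _ => ?_
      filter_upwards [Ioo_mem_nhdsGT i.2.2] with ε hε using hε.2.le
    obtain ⟨ε, hεa, hε0⟩ := (hε.and self_mem_nhdsWithin).exists
    obtain ⟨z, hz, u, h⟩ := exists_approx_multiplier_finset hS hSne hf hG hGneg hconc hr
      (a.image fun i => (i.1 : X)) (by simp +contextual) hε0
    have hzs : 0 ≤ z s₀ := hz s₀ (interior_subset hs₀)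
    have hpos : 0 < 1 + z s₀ := by linarith
    have hinv : 0 < (1 + z s₀)⁻¹ := inv_pos.2 hpos
    have hmul : (1 + z s₀)⁻¹ * (1 + z s₀) = 1 := inv_mul_cancel₀ hpos.ne'
    have hwB : (1 + z s₀)⁻¹ • z ∈ B := by
      refine ⟨smul_mem_dualCone hinv.le hz, ?_⟩
      change (1 + z s₀)⁻¹ * z s₀ ≤ 1
      linarith
    refine ⟨((1 + z s₀)⁻¹ • z, u), ⟨hwB, mem_univ _⟩, mem_iInter₂.2 fun i hi => ⟨hwB, ?_⟩⟩
    have hx := h i.1 (Finset.mem_image_of_mem _ hi)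
    have hne := hGneg u i.1
    change (((1 - (1 + z s₀)⁻¹ * z s₀) * (r - i.2 - f i.1) : ℝ) : EReal) ≤
      (G u i.1).pair ((1 + z s₀)⁻¹ • z : WeakDual ℝ Z)
    generalize G u i.1 = g at hx hne
    cases g with
    | negInf => exact absurd rfl hne
    | posInf => exact le_pair_posInf
    | pt y =>
      refine le_pair_pt.2 ?_
      change _ ≤ (1 + z s₀)⁻¹ * z y
      rw [show 1 - (1 + z s₀)⁻¹ * z s₀ = (1 + z s₀)⁻¹ by linarith]
      refine mul_le_mul_of_nonneg_left ?_ hinv.le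
      have := le_pair_pt.1 hx
      have := hεa i hi
      linarith
  obtain ⟨⟨z, u⟩, ⟨hzB, -⟩, hzu⟩ :=
    (hB.prod isCompact_univ).inter_iInter_nonempty Λ hΛ hfip
  have hzB : z ∈ B := hzB
  have hbound : ∀ x ∈ D, ∀ y, G u x = pt y → (1 - z s₀) * (r - f x) ≤ z y := by
    intro x hx y hy
    have hlim : Tendsto (fun ε : ℝ => (1 - z s₀) * (r - ε - f x)) (𝓝[>] 0)
        (𝓝 ((1 - z s₀) * (r - f x))) := by
      have : Continuous fun ε : ℝ => (1 - z s₀) * (r - ε - f x) := by fun_prop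
      simpa using (this.tendsto 0).mono_left nhdsWithin_le_nhds
    refine le_of_tendsto hlim ?_
    filter_upwards [self_mem_nhdsWithin] with ε hε
    have h := (mem_iInter.1 hzu (⟨x, hx⟩, ⟨ε, hε⟩)).2
    simp only [hy] at h
    exact le_pair_pt.1 h
  -- If `z s₀ = 1`, the objective disappears and `0 ≤ z y` at the Slater point of `u`; but `z ≠ 0`
  -- is positive at `-y ∈ interior S`.
  have hlt : 0 < 1 - z s₀ := by
    refine lt_of_le_of_ne (by linarith [hzB.2]) fun h => ?_
    obtain ⟨x, hx, y, hy, hxy⟩ := hslater u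
    have h1 := hbound x hx y hxy.symm
    rw [← h, zero_mul] at h1
    have hz0 : (z : Z →L[ℝ] ℝ) ≠ 0 := by
      intro h0
      have : z s₀ = 0 := DFunLike.congr_fun h0 s₀
      linarith
    have h2 := pos_of_mem_interior (K := S) (z : Z →L[ℝ] ℝ) hz0 hzB.1 (k := -y) hy
    have h2 : 0 < z (-y) := h2
    rw [map_neg] at h2
    linarith
  refine ⟨(1 - z s₀)⁻¹ • z, smul_mem_dualCone (inv_pos.2 hlt).le hzB.1, u, fun x hx y hy => ?_⟩
  change r ≤ f x + (1 - z s₀)⁻¹ * z y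
  have := mul_le_mul_of_nonneg_left (hbound x hx y hy) (inv_pos.2 hlt).le
  rw [← mul_assoc, inv_mul_cancel₀ hlt.ne', one_mul] at this
  linarith

end Multiplier

end RobustVector

namespace RobustVector

open Bullet

theorem pt_wLt_pt {Y : Type*} [AddCommGroup Y] [TopologicalSpace Y] {K : Set Y} {a b : Y} :
    WLt K (pt a) (pt b) ↔ b - a ∈ interior K := by
  change -(a - b) ∈ interior K ↔ _
  rw [neg_sub]

/-! ### The weak order and weak infima. -/

section WeakOrder

variable {Y : Type*} [AddCommGroup Y] [Module ℝ Y] [TopologicalSpace Y] [IsTopologicalAddGroup Y]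
  [ContinuousSMul ℝ Y] {K : ConvexCone ℝ Y} {P D : Set (Bullet Y)}

theorem wLt_pt_of_sub_mem {v : Bullet Y} {a b : Y} (h : WLt (K : Set Y) v (pt a))
    (hab : b - a ∈ K) : WLt (K : Set Y) v (pt b) := by
  cases v with
  | negInf => trivial
  | posInf => exact h
  | pt y =>
    rw [pt_wLt_pt] at h ⊢
    have := interior_add_mem h hab
    rwa [show a - y + (b - a) = b - y by abel] at this

theorem pt_wLt_of_sub_mem {w : Bullet Y} {a b : Y} (h : WLt (K : Set Y) (pt b) w)
    (hab : b - a ∈ K) : WLt (K : Set Y) (pt a) w := by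
  cases w with
  | negInf => exact h
  | posInf => trivial
  | pt y =>
    rw [pt_wLt_pt] at h ⊢
    have := interior_add_mem h hab
    rwa [show y - b + (b - a) = y - a by abel] at this

/-- If `v` lies below some `w'` that no element of `P` is below, then a weakly infimal element of `P`
lies above `v`. -/
theorem exists_mem_wInf_of_wLt (h0 : (0 : Y) ∈ K) (hint : (interior (K : Set Y)).Nonempty)
    {p₀ : Y} (hp₀ : pt p₀ ∈ P) {v w' : Bullet Y} (hv : WLt (K : Set Y) v w')
    (hw' : ∀ p ∈ P, ¬ WLt (K : Set Y) p w') :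
    ∃ w ∈ wInf (K : Set Y) P, WLt (K : Set Y) v w := by
  cases w' with
  | negInf => cases v <;> exact hv.elim
  | posInf => exact absurd trivial (hw' _ hp₀)
  | pt y =>
    obtain ⟨k, hk⟩ := hint
    -- The point moves from `y` along `k` as far as no element of `P` lies below it; the supremum of
    -- these parameters gives a weakly infimal point, because `interior K` is open.
    let A : Set ℝ := {t | ∀ p ∈ P, ¬ WLt (K : Set Y) p (pt (y + t • k))}
    have hA0 : (0 : ℝ) ∈ A := fun p hp => by
      rw [zero_smul, add_zero]; exact hw' p hp
    obtain ⟨t₀, -, ht₀⟩ := exists_add_smul_mem_interior (y - p₀) hk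
    have hAb : BddAbove A := by
      refine ⟨t₀, fun t ht => ?_⟩
      by_contra! hlt
      refine ht _ hp₀ (pt_wLt_pt.2 ?_)
      have := interior_add_mem ht₀ (K.smul_mem (sub_pos.2 hlt) (interior_subset hk))
      rw [sub_smul] at this
      convert this using 1
      abel
    set τ := sSup A with hτ
    have hτ0 : 0 ≤ τ := le_csSup hAb hA0
    have hopen : ∀ c : Y, IsOpen {t : ℝ | y + t • k - c ∈ interior (K : Set Y)} := fun c =>
      isOpen_interior.preimage (by fun_prop)
    have hopen' : ∀ c : Y, IsOpen {t : ℝ | c - (y + t • k) ∈ interior (K : Set Y)} := fun c =>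
      isOpen_interior.preimage (by fun_prop)
    refine ⟨pt (y + τ • k), ⟨fun p hp hlt => ?_, fun w'' hlt => ?_⟩, ?_⟩
    · cases p with
      | negInf => exact hw' _ hp trivial
      | posInf => exact hlt
      | pt p =>
        rw [pt_wLt_pt] at hlt
        obtain ⟨δ, hδ, hball⟩ := Metric.isOpen_iff.1 (hopen p) τ hlt
        obtain ⟨t, htA, ht⟩ := exists_lt_of_lt_csSup ⟨0, hA0⟩ (sub_lt_self τ hδ)
        refine htA _ hp (pt_wLt_pt.2 (hball ?_))
        have := le_csSup hAb htA
        rw [Metric.mem_ball, Real.dist_eq, abs_lt]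
        constructor <;> linarith
    · cases w'' with
      | negInf => exact hlt.elim
      | posInf => exact ⟨_, hp₀, trivial⟩
      | pt b =>
        rw [pt_wLt_pt] at hlt
        obtain ⟨δ, hδ, hball⟩ := Metric.isOpen_iff.1 (hopen' b) τ hlt
        have hb : b - (y + (τ + δ / 2) • k) ∈ interior (K : Set Y) := hball (by
          rw [Metric.mem_ball, Real.dist_eq, abs_lt]
          constructor <;> linarith)
        have hnA : τ + δ / 2 ∉ A := fun h => by
          have := le_csSup hAb h
          linarith
        simp only [A, mem_ofPred_eq, not_forall, not_not] at hnA
        obtain ⟨p, hp, hpt⟩ := hnA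
        exact ⟨p, hp, wLt_pt_of_sub_mem hpt (interior_subset hb)⟩
    · refine wLt_pt_of_sub_mem hv ?_
      rw [add_sub_cancel_left]
      rcases hτ0.eq_or_lt with h | h
      · rw [← h, zero_smul]; exact h0
      · exact K.smul_mem h (interior_subset hk)

/-- Weak duality together with attainment at every weakly infimal value gives equality of the weak
maximum and the weak infimum. -/
theorem wMax_eq_wInf (h0 : (0 : Y) ∈ K) (hint : (interior (K : Set Y)).Nonempty)
    {p₀ : Y} (hp₀ : pt p₀ ∈ P) (hweak : ∀ v ∈ D, ∀ p ∈ P, ¬ WLt (K : Set Y) p v)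
    (hstrong : wInf (K : Set Y) P ⊆ D) : wMax (K : Set Y) D = wInf (K : Set Y) P := by
  refine Subset.antisymm ?_ fun w hw => ?_
  · rintro v ⟨hvD, hv, -⟩
    refine ⟨hweak v hvD, fun w' hw' => ?_⟩
    by_contra! hcon
    -- A gap above `v` would contain a weakly infimal value of `P`, itself in `D`, contradicting the
    -- maximality of `v`.
    obtain ⟨w, hw, hvw⟩ := exists_mem_wInf_of_wLt h0 hint hp₀ hw' hcon
    exact hv w (hstrong hw) hvw
  · refine ⟨hstrong hw, fun v hv hwv => ?_, fun w' hw' => ⟨w, hstrong hw, hw'⟩⟩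
    obtain ⟨p, hp, hpv⟩ := hw.2 v hwv
    exact hweak v hv p hp hpv

end WeakOrder

/-! ### Comparison of value sets. -/

section Minorant

variable {Y : Type*} [AddCommGroup Y] [TopologicalSpace Y] {K : Set Y} {M P : Set (Bullet Y)}

/-- `M` contains, for every element of `P`, an element that is at least as small. -/
def Minorizes (K : Set Y) (M P : Set (Bullet Y)) : Prop :=
  ∀ p ∈ P, ∃ v ∈ M, ∀ w, WLt K p w → WLt K v w

theorem Minorizes.not_wLt_of_mem_wInf (h : Minorizes K M P) {w : Bullet Y} (hw : w ∈ wInf K M) :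
    ∀ p ∈ P, ¬ WLt K p w := fun p hp hpw =>
  let ⟨v, hv, hvw⟩ := h p hp
  hw.1 v hv (hvw w hpw)

/-- The approximation half of weak infimality passes from `P` to `M`, so attainment in the dual
reduces to the lower-bound half. -/
theorem Minorizes.mem_wInf (h : Minorizes K M P) {w : Bullet Y} (hw : w ∈ wInf K P)
    (hM : ∀ v ∈ M, ¬ WLt K v w) : w ∈ wInf K M :=
  ⟨hM, fun w' hw' =>
    let ⟨p, hp, hpw⟩ := hw.2 w' hw'
    let ⟨v, hv, hvw⟩ := h p hp
    ⟨v, hv, hvw w' hpw⟩⟩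

end Minorant

/-! ### Scalarization and weak duality for the vector problem. -/

section Duality

variable {X Y Z U : Type*}
  [AddCommGroup X] [Module ℝ X] [TopologicalSpace X]
  [AddCommGroup Y] [Module ℝ Y] [TopologicalSpace Y] [IsTopologicalAddGroup Y]
  [ContinuousSMul ℝ Y]
  {C : Set X} {F : X → Bullet Y} {K : ConvexCone ℝ Y}

theorem IsConeConvex.exists_of_mem (hF : IsConeConvex (K : Set Y) F) {x₁ x₂ : X} {y₁ y₂ : Y}
    (h₁ : (x₁, y₁) ∈ epigraph (K : Set Y) F) (h₂ : (x₂, y₂) ∈ epigraph (K : Set Y) F) {s t : ℝ}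
    (hs : 0 ≤ s) (ht : 0 ≤ t) (hst : s + t = 1) :
    ∃ b, F (s • x₁ + t • x₂) = pt b ∧ s • y₁ + t • y₂ - b ∈ K :=
  mem_epigraph_iff.1 (hF h₁ h₂ hs ht hst)

theorem convex_inter_dom (hC : Convex ℝ C) (h0 : (0 : Y) ∈ K) (hFneg : ∀ x, F x ≠ negInf)
    (hF : IsConeConvex (K : Set Y) F) : Convex ℝ (C ∩ dom F) := by
  rintro x₁ ⟨h₁, h₁'⟩ x₂ ⟨h₂, h₂'⟩ s t hs ht hst
  obtain ⟨b, hb, -⟩ := hF.exists_of_mem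
    (mem_epigraph_of_eq (eq_pt_fin (hFneg x₁) h₁') (y := (F x₁).fin) (by rwa [sub_self]))
    (mem_epigraph_of_eq (eq_pt_fin (hFneg x₂) h₂') (y := (F x₂).fin) (by rwa [sub_self])) hs ht hst
  exact ⟨hC h₁ h₂ hs ht hst, by rw [dom, mem_ofPred_eq, hb]; exact fun h => nomatch h⟩

theorem convexOn_comp_sub (hC : Convex ℝ C) (h0 : (0 : Y) ∈ K) (hFneg : ∀ x, F x ≠ negInf)
    (hF : IsConeConvex (K : Set Y) F) (L : X →L[ℝ] Y) {f : Y →L[ℝ] ℝ} (hf : ∀ k ∈ K, 0 ≤ f k) :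
    ConvexOn ℝ (C ∩ dom F) fun x => f ((F x).fin - L x) := by
  refine ⟨convex_inter_dom hC h0 hFneg hF, ?_⟩
  rintro x₁ ⟨-, h₁⟩ x₂ ⟨-, h₂⟩ s t hs ht hst
  obtain ⟨b, hb, hk⟩ := hF.exists_of_mem
    (mem_epigraph_of_eq (eq_pt_fin (hFneg x₁) h₁) (y := (F x₁).fin) (by rwa [sub_self]))
    (mem_epigraph_of_eq (eq_pt_fin (hFneg x₂) h₂) (y := (F x₂).fin) (by rwa [sub_self])) hs ht hst
  have := hf _ hk
  simp only [hb, Bullet.fin, map_sub, map_add, map_smul, smul_eq_mul] at this ⊢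
  linarith

variable [NormedAddCommGroup Z] [NormedSpace ℝ Z] {S : ConvexCone ℝ Z} {G : U → X → Bullet Z}

theorem convex_feasible (hC : Convex ℝ C) (hG : ∀ u, IsConeConvex (S : Set Z) (G u)) :
    Convex ℝ (feasible (S : Set Z) C G) := by
  rintro x₁ ⟨h₁, h₁'⟩ x₂ ⟨h₂, h₂'⟩ s t hs ht hst
  refine ⟨hC h₁ h₂ hs ht hst, fun u => ?_⟩
  obtain ⟨y₁, hy₁, e₁⟩ := h₁' u
  obtain ⟨y₂, hy₂, e₂⟩ := h₂' u
  obtain ⟨b, hb, hk⟩ := (hG u).exists_of_mem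
    (mem_epigraph_of_eq e₁.symm (y := 0) (by rw [zero_sub]; exact hy₁))
    (mem_epigraph_of_eq e₂.symm (y := 0) (by rw [zero_sub]; exact hy₂)) hs ht hst
  refine ⟨b, ?_, hb.symm⟩
  rwa [smul_zero, smul_zero, add_zero, zero_sub] at hk

/-- Below a value `b` that no primal value is weakly smaller than, some positive operator and some
functional positive on `int K` bound the scalarized Lagrangian. -/
theorem exists_posOps_scalarization [TopologicalSpace U] [CompactSpace U] [Nonempty U]
    (hK : IsClosed (K : Set Y)) (hint : (interior (K : Set Y)).Nonempty)
    (hSne : (S : Set Z).Nonempty) (hS : IsClosed (S : Set Z))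
    (hFneg : ∀ x, F x ≠ negInf) (hGneg : ∀ u x, G u x ≠ negInf)
    (hfeas : (feasible (S : Set Z) C G ∩ dom F).Nonempty)
    (hF : IsConeConvex (K : Set Y) F) (hG : ∀ u, IsConeConvex (S : Set Z) (G u))
    (hC : Convex ℝ C)
    (hconc : UniformlyConcave (S : Set Z) (C ∩ dom F) fun x u => G u x)
    (husc : ∀ x ∈ C ∩ dom F, UniformlyUsc (S : Set Z) fun u => G u x)
    (hslater : ∀ u, ∃ x ∈ C ∩ dom F, G u x ∈ pt '' (-interior (S : Set Z)))
    (L : X →L[ℝ] Y) {b : Y}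
    (hb : ∀ p ∈ primalValues (S : Set Z) C F G L, ¬ WLt (K : Set Y) p (pt b)) :
    ∃ T ∈ posOps (S : Set Z) (K : Set Y), ∃ u, ∃ f : Y →L[ℝ] ℝ,
      (∀ k ∈ K, 0 ≤ f k) ∧ (∀ k ∈ interior (K : Set Y), 0 < f k) ∧
      ∀ x ∈ C, ∀ a, lagrangian F G L T u x = pt a → f b ≤ f a := by
  have h0 : (0 : Y) ∈ K := zero_mem_of_isClosed hK (hint.mono interior_subset)
  let P : Set Y := (fun x => (F x).fin - L x) '' (feasible (S : Set Z) C G ∩ dom F)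
  have hconv : Convex ℝ (P + (K : Set Y)) := by
    rintro _ ⟨_, ⟨x₁, ⟨hx₁, hd₁⟩, rfl⟩, k₁, hk₁, rfl⟩ _ ⟨_, ⟨x₂, ⟨hx₂, hd₂⟩, rfl⟩, k₂, hk₂, rfl⟩
      s t hs ht hst
    obtain ⟨y, hy, hk⟩ := hF.exists_of_mem
      (mem_epigraph_of_eq (eq_pt_fin (hFneg x₁) hd₁) (y := (F x₁).fin + k₁) (by
        rw [add_sub_cancel_left]; exact hk₁))
      (mem_epigraph_of_eq (eq_pt_fin (hFneg x₂) hd₂) (y := (F x₂).fin + k₂) (by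
        rw [add_sub_cancel_left]; exact hk₂)) hs ht hst
    refine ⟨_, ⟨s • x₁ + t • x₂, ⟨convex_feasible hC hG hx₁ hx₂ hs ht hst, ?_⟩, rfl⟩, _, hk, ?_⟩
    · rw [dom, mem_ofPred_eq, hy]; exact fun h => nomatch h
    · simp only [hy, Bullet.fin, map_add, map_smul, smul_add, smul_sub]
      abel
  obtain ⟨f, hf0, hfK, hfP⟩ := exists_separating_functional hint hconv (hfeas.image _) h0
    (w := b) (by
      rintro _ ⟨x, ⟨hx, hd⟩, rfl⟩ hmem
      refine hb _ ⟨x, hx, rfl⟩ ?_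
      have e : F x + pt (-L x) = pt ((F x).fin - L x) := by
        rw [eq_pt_fin (hFneg x) hd]; exact congrArg pt (sub_eq_add_neg _ _).symm
      simp only [e]
      exact pt_wLt_pt.2 hmem)
  have hpos : ∀ k ∈ interior (K : Set Y), 0 < f k := fun k hk => pos_of_mem_interior f hf0 hfK hk
  obtain ⟨z, hz, u, hzu⟩ := exists_robust_multiplier hS hSne
    (convexOn_comp_sub hC h0 hFneg hF L hfK) hG hGneg hconc husc hslater (r := f b)
    fun x hx hxu => hfP _ ⟨x, ⟨⟨hx.1, hxu⟩, hx.2⟩, rfl⟩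
  obtain ⟨k, hk⟩ := hint
  have hfk := hpos k hk
  -- The factor `(f k)⁻¹` gives `f ∘ T = z`; `T` is positive because it maps `S` into the ray
  -- through `k`.
  let T : Z →L[ℝ] Y := (z : Z →L[ℝ] ℝ).smulRight ((f k)⁻¹ • k)
  have hT : ∀ y, T y = z y • (f k)⁻¹ • k := fun _ => rfl
  refine ⟨T, ?_, u, f, hfK, hpos, fun x hx a ha => ?_⟩
  · rintro _ ⟨s, hs, rfl⟩
    rw [hT]
    rcases (show 0 ≤ z s from hz s hs).eq_or_lt with h | h
    · rw [← h, zero_smul]; exact h0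
    · exact K.smul_mem h (K.smul_mem (inv_pos.2 hfk) (interior_subset hk))
  · have hFx := hFneg x
    have hGx := hGneg u x
    have key := hzu x
    rw [lagrangian] at ha
    simp only [dom, mem_inter_iff, mem_ofPred_eq] at key
    generalize F x = v at *
    generalize G u x = g at *
    cases v with
    | negInf => exact absurd rfl hFx
    | posInf => cases g <;> cases ha
    | pt y =>
      cases g with
      | negInf => exact absurd rfl hGx
      | posInf => cases ha
      | pt g =>
        have ha : pt (y + -L x + T g) = pt a := ha
        rw [← pt.inj ha, hT]
        have := key ⟨hx, fun h => nomatch h⟩ g rfl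
        simp only [Bullet.fin, map_sub, map_add, map_neg, map_smul, smul_eq_mul] at this ⊢
        rw [inv_mul_cancel₀ hfk.ne', mul_one]
        linarith

theorem minorizes_lagrangian (L : X →L[ℝ] Y) {T : Z →L[ℝ] Y}
    (hT : T ∈ posOps (S : Set Z) (K : Set Y)) (u : U) :
    Minorizes (K : Set Y) ((fun x => lagrangian F G L T u x) '' C)
      (primalValues (S : Set Z) C F G L) := by
  rintro _ ⟨x, ⟨hx, hxu⟩, rfl⟩
  refine ⟨_, mem_image_of_mem _ hx, fun w hw => ?_⟩
  obtain ⟨y, hy, hyx⟩ := hxu u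
  simp only [lagrangian, ← hyx] at hw ⊢
  generalize F x = v at *
  cases v with
  | negInf => exact hw
  | posInf => cases w <;> exact hw.elim
  | pt a =>
    refine pt_wLt_of_sub_mem (a := a + -L x + T y) (b := a + -L x) hw ?_
    have := hT (mem_image_of_mem T (show -y ∈ (S : Set Z) from hy))
    rw [map_neg] at this
    rwa [sub_add_cancel_left]

theorem minorizes_weakLagrangian (L : X →L[ℝ] Y) (T : Z →L[ℝ] Y) (u : U) :
    Minorizes (K : Set Y)
      ((fun p : X × Z => lagrangian F G L T u p.1 + pt (T p.2)) '' (C ×ˢ (S : Set Z)))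
      (primalValues (S : Set Z) C F G L) := by
  rintro _ ⟨x, ⟨hx, hxu⟩, rfl⟩
  obtain ⟨y, hy, hyx⟩ := hxu u
  refine ⟨_, ⟨(x, -y), ⟨hx, hy⟩, rfl⟩, fun w hw => ?_⟩
  simp only [lagrangian, ← hyx] at hw ⊢
  generalize F x = v at *
  cases v with
  | negInf => exact hw
  | posInf => cases w <;> exact hw.elim
  | pt a =>
    have e : a + -L x + T y + T (-y) = a + -L x := by rw [map_neg, add_neg_cancel_right]
    exact (congrArg (fun c => WLt (K : Set Y) (pt c) w) e).mpr hw

theorem zero_mem_posOps (h0 : (0 : Y) ∈ K) :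
    (0 : Z →L[ℝ] Y) ∈ posOps (S : Set Z) (K : Set Y) := by
  rintro _ ⟨s, -, rfl⟩
  exact h0

/-- A point of `K` whose negative is interior would put `0` in the interior, impossible for a proper
cone. -/
theorem posOps_subset_weakPosOps (hK : (K : Set Y) ≠ univ) :
    posOps (S : Set Z) (K : Set Y) ⊆ weakPosOps (S : Set Z) (K : Set Y) := by
  refine fun T hT => eq_empty_iff_forall_notMem.2 fun y ⟨hy, hy'⟩ => zero_notMem_interior hK ?_
  have := add_interior_mem (hT hy) (show -y ∈ interior (K : Set Y) from hy')
  rwa [add_neg_cancel] at this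

theorem lagrangian_ne_negInf (hFneg : ∀ x, F x ≠ negInf) (hGneg : ∀ u x, G u x ≠ negInf)
    (L : X →L[ℝ] Y) (T : Z →L[ℝ] Y) (u : U) (x : X) : lagrangian F G L T u x ≠ negInf := by
  have h₁ := hFneg x
  have h₂ := hGneg u x
  rw [lagrangian]
  generalize F x = v at *
  generalize G u x = g at *
  cases v <;> cases g <;> first | exact absurd rfl h₁ | exact absurd rfl h₂ | exact fun h => nomatch h

end Duality

end RobustVector
-- Strong stable duality for both duals.
theorem theorem6p4 {X Y Z U : Type*}
    [AddCommGroup X] [Module ℝ X] [TopologicalSpace X] [IsTopologicalAddGroup X]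
    [ContinuousSMul ℝ X] [LocallyConvexSpace ℝ X] [T2Space X]
    [AddCommGroup Y] [Module ℝ Y] [TopologicalSpace Y] [IsTopologicalAddGroup Y]
    [ContinuousSMul ℝ Y] [LocallyConvexSpace ℝ Y] [T2Space Y]
    [NormedAddCommGroup Z] [NormedSpace ℝ Z]
    [TopologicalSpace U] [CompactSpace U] [Nonempty U]
    (K : ConvexCone ℝ Y) (hK_closed : IsClosed (K : Set Y))
    (hK_ne : (K : Set Y) ≠ Set.univ) (hK_int : (interior (K : Set Y)).Nonempty)
    (S : ConvexCone ℝ Z) (hS_nonempty : (S : Set Z).Nonempty) (hS_closed : IsClosed (S : Set Z))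
    (C : Set X) (F : X → RobustVector.Bullet Y) (G : U → X → RobustVector.Bullet Z)
    (hF_proper : RobustVector.IsProper F) (hG_proper : ∀ u, RobustVector.IsProper (G u))
    (h_feas : (RobustVector.feasible (S : Set Z) C G ∩ RobustVector.dom F).Nonempty)
    -- convexity and closedness of the data
    (hF_convex : RobustVector.IsConeConvex (K : Set Y) F)
    (hF_lsc : RobustVector.IsPositivelyLsc (K : Set Y) F)
    (hG_convex : ∀ u, RobustVector.IsConeConvex (S : Set Z) (G u))
    (hG_closed : ∀ u, RobustVector.IsEpiClosed (S : Set Z) (G u))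
    (hC_nonempty : C.Nonempty) (hC_closed : IsClosed C) (hC_convex : Convex ℝ C)
    -- uniform concavity in the uncertainty
    (h_concave : RobustVector.UniformlyConcave (S : Set Z) (C ∩ RobustVector.dom F)
      (fun x u => G u x))
    -- uniform upper semicontinuity in the uncertainty
    (h_usc : ∀ x ∈ C ∩ RobustVector.dom F,
      RobustVector.UniformlyUsc (S : Set Z) (fun u => G u x))
    -- Slater-type condition
    (h_slater : ∀ u, ∃ x ∈ C ∩ RobustVector.dom F,
      G u x ∈ RobustVector.Bullet.pt '' (-interior (S : Set Z))) :
    RobustVector.StrongStableDuality (K : Set Y) (S : Set Z) C F G ∧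
      RobustVector.WeakStrongStableDuality (K : Set Y) (S : Set Z) C F G := by
  have h0 : (0 : Y) ∈ K :=
    RobustVector.zero_mem_of_isClosed hK_closed (hK_int.mono interior_subset)
  have hFneg := hF_proper.2
  have hGneg := fun u => (hG_proper u).2
  refine ⟨fun L => ?_, fun L => ?_⟩ <;>
  obtain ⟨p₀, hp₀⟩ : ∃ p, RobustVector.Bullet.pt p ∈
      RobustVector.primalValues (S : Set Z) C F G L := by
    obtain ⟨x, hx, hd⟩ := h_feas
    refine ⟨(F x).fin + -L x, x, hx, ?_⟩
    simp only
    rw [RobustVector.Bullet.eq_pt_fin (hFneg x) hd]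
    rfl
  · refine RobustVector.wMax_eq_wInf h0 hK_int hp₀ (fun v hv => ?_) fun w hw => ?_
    · obtain ⟨T, hT, hv⟩ := mem_iUnion₂.1 hv
      obtain ⟨u, hv⟩ := mem_iUnion.1 hv
      exact (RobustVector.minorizes_lagrangian L hT u).not_wLt_of_mem_wInf hv
    · suffices h : ∃ T ∈ RobustVector.posOps (S : Set Z) (K : Set Y), ∃ u, ∀ x ∈ C,
          ¬ RobustVector.Bullet.WLt (K : Set Y) (RobustVector.lagrangian F G L T u x) w by
        obtain ⟨T, hT, u, h⟩ := h
        refine mem_iUnion₂.2 ⟨T, hT, mem_iUnion.2 ⟨u, ?_⟩⟩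
        exact (RobustVector.minorizes_lagrangian L hT u).mem_wInf hw (forall_mem_image.2 h)
      cases w with
      | negInf =>
        refine ⟨0, RobustVector.zero_mem_posOps h0, Classical.arbitrary U, fun x _ h => ?_⟩
        generalize RobustVector.lagrangian F G L 0 _ x = v at h
        cases v <;> exact h
      | posInf => exact absurd trivial (hw.1 _ hp₀)
      | pt b =>
        obtain ⟨T, hT, u, f, -, hpos, hle⟩ := RobustVector.exists_posOps_scalarization hK_closed
          hK_int hS_nonempty hS_closed hFneg hGneg h_feas hF_convex hG_convex hC_convex h_concave
          h_usc h_slater L hw.1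
        refine ⟨T, hT, u, fun x hx h => ?_⟩
        have hne := RobustVector.lagrangian_ne_negInf hFneg hGneg L T u x
        have hle := hle x hx
        generalize RobustVector.lagrangian F G L T u x = v at *
        cases v with
        | negInf => exact hne rfl
        | posInf => exact h
        | pt a =>
          have h1 := hpos _ (RobustVector.pt_wLt_pt.1 h)
          have h2 := hle a rfl
          rw [map_sub] at h1
          linarith
  · refine RobustVector.wMax_eq_wInf h0 hK_int hp₀ (fun v hv => ?_) fun w hw => ?_
    · obtain ⟨T, -, hv⟩ := mem_iUnion₂.1 hv
      obtain ⟨u, hv⟩ := mem_iUnion.1 hv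
      exact (RobustVector.minorizes_weakLagrangian L T u).not_wLt_of_mem_wInf hv
    -- A positive operator already attains the weak dual: the extra term satisfies `f (T s) ≥ 0`, so
    -- the scalar bound survives.
    · suffices h : ∃ T ∈ RobustVector.posOps (S : Set Z) (K : Set Y), ∃ u, ∀ x ∈ C, ∀ s ∈ S,
          ¬ RobustVector.Bullet.WLt (K : Set Y)
            (RobustVector.lagrangian F G L T u x + RobustVector.Bullet.pt (T s)) w by
        obtain ⟨T, hT, u, h⟩ := h
        refine mem_iUnion₂.2 ⟨T, RobustVector.posOps_subset_weakPosOps hK_ne hT,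
          mem_iUnion.2 ⟨u, ?_⟩⟩
        exact (RobustVector.minorizes_weakLagrangian L T u).mem_wInf hw
          (forall_mem_image.2 fun p hp => h p.1 hp.1 p.2 hp.2)
      cases w with
      | negInf =>
        refine ⟨0, RobustVector.zero_mem_posOps h0, Classical.arbitrary U, fun x _ s _ h => ?_⟩
        generalize RobustVector.lagrangian F G L 0 _ x = v at h
        cases v <;> exact h
      | posInf => exact absurd trivial (hw.1 _ hp₀)
      | pt b =>
        obtain ⟨T, hT, u, f, hfK, hpos, hle⟩ := RobustVector.exists_posOps_scalarization hK_closed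
          hK_int hS_nonempty hS_closed hFneg hGneg h_feas hF_convex hG_convex hC_convex h_concave
          h_usc h_slater L hw.1
        refine ⟨T, hT, u, fun x hx s hs h => ?_⟩
        have hne := RobustVector.lagrangian_ne_negInf hFneg hGneg L T u x
        have hle := hle x hx
        generalize RobustVector.lagrangian F G L T u x = v at *
        cases v with
        | negInf => exact hne rfl
        | posInf => exact h
        | pt a =>
          have h : RobustVector.Bullet.WLt (K : Set Y) (.pt (a + T s)) (.pt b) := h
          have h1 := hpos _ (RobustVector.pt_wLt_pt.1 h)
          have h2 := hle a rfl
          have h3 := hfK _ (hT (mem_image_of_mem T hs))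
          rw [map_sub, map_add] at h1
          linarith
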